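/- A deterministic push-down automaton (DPDA) $M=(Q,\Sigma,\Gamma,\delta,\bot)$ consists of finite sets $Q$ (states), $\Sigma$ (input alphabet) and $\Gamma$ (stack alphabet), a bottom symbol $\bot\in\Gamma$ and a total transition function $\delta\colon Q\times\Sigma\times\Gamma\to Q\times\Gamma^*$ such that, whenever $\delta(q,\sigma,x)=(q',\gamma)$ and $\gamma$ contains $\bot$, then $x=\bot$ and $\bot$ occurs in $\gamma$ only as its first symbol. (So $M$ is real-time: there are no $\varepsilon$-transitions.) It is a deterministic one-counter automaton (DCA) if $|\Gamma\setminus\{\bot\}|=1$; testing whether $\bot$ is on top of the stack is a zero test. A configuration is a pair $(q,\upsilon)\in Q\times\Gamma^*$, the top of the stack being the right end of $\upsilon$; on a letter $\sigma$ the configuration $(q,ux)$ with $u\in\Gamma^*$, $x\in\Gamma$ is changed to $(q',u\gamma)$ where $\delta(q,\sigma,x)=(q',\gamma)$, and no step is possible from a configuration with stack content $\varepsilon$. For $w\in\Sigma^*$ write $c\xrightarrow{w}c'$ if reading $w$ leads from $c$ to $c'$. A word $w\in\Sigma^*$ synchronizes $M$ - in the empty stack model if there is $\bar q\in Q$ with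 $(q,\bot)\xrightarrow{w}(\bar q,\bot)$ for all $q\in Q$; - in the same stack model if there are $\bar q\in Q$ and $\upsilon\in\Gamma^*$ with $(q,\bot)\xrightarrow{w}(\bar q,\upsilon)$ for all $q\in Q$; - in the arbitrary stack model if there is $\bar q\in Q$ such that for every $q\in Q$ there is $\upsilon_q\in\Gamma^*$ with $(q,\bot)\xrightarrow{w}(\bar q,\upsilon_q)$. Theorem. For each of these three stack models, the following problem is undecidable: given a DCA $M$ (by its transition table), does there exist a word $w\in\Sigma^*$ that synchronizes $M$ in that stack model? -/

import Mathlib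

/-- A deterministic real-time push-down automaton with state set `Q`, input alphabet `A` and stack
alphabet `S` (start and final states play no role for synchronization). The transition function is
total and there are no transitions on the empty word. Stack contents, and the words that replace the
top symbol, are written with the top of the stack at the right end. -/
structure DPDA (Q A S : Type) where
  /-- The transition function. -/
  δ : Q → A → S → Q × List S
  /-- The stack bottom symbol. -/
  bot : S
  /-- The bottom symbol is written only when it is the symbol being replaced, and then only once, as
  the first (lowest) symbol. -/
  bot_lowest : ∀ q a x, bot ∈ (δ q a x).2 →
    x = bot ∧ ∃ v : List S, (δ q a x).2 = bot :: v ∧ bot ∉ v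

namespace DPDA

variable {Q A S : Type}

/-- One step on the letter `a`: the top symbol `x` of the stack content `u ++ [x]` is replaced. There
is no step from a configuration whose stack content is the empty word. -/
def Step (M : DPDA Q A S) (a : A) (c c' : Q × List S) : Prop :=
  ∃ (u : List S) (x : S), c.2 = u ++ [x] ∧ c' = ((M.δ c.1 a x).1, u ++ (M.δ c.1 a x).2)

/-- `M.Run w c c'`: reading the word `w` leads from the configuration `c` to `c'`. -/
def Run (M : DPDA Q A S) : List A → Q × List S → Q × List S → Prop
  | [], c, c' => c = c'
  | a :: w, c, c' => ∃ d, M.Step a c d ∧ M.Run w d c'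

/-- `w` synchronizes `M` in the empty stack model. -/
def SynchronizesEmpty (M : DPDA Q A S) (w : List A) : Prop :=
  ∃ p : Q, ∀ q : Q, M.Run w (q, [M.bot]) (p, [M.bot])

/-- `w` synchronizes `M` in the same stack model. -/
def SynchronizesSame (M : DPDA Q A S) (w : List A) : Prop :=
  ∃ (p : Q) (v : List S), ∀ q : Q, M.Run w (q, [M.bot]) (p, v)

/-- `w` synchronizes `M` in the arbitrary stack model. -/
def SynchronizesArb (M : DPDA Q A S) (w : List A) : Prop :=
  ∃ p : Q, ∀ q : Q, ∃ v : List S, M.Run w (q, [M.bot]) (p, v)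

/-- `M` is a deterministic (one-)counter automaton: there is exactly one stack symbol besides the
bottom symbol. -/
def IsDCA (M : DPDA Q A S) : Prop :=
  ({M.bot}ᶜ : Set S).ncard = 1

end DPDA

/-- A deterministic one-counter automaton as an input of a decision problem: its finite sets of states,
letters and stack symbols are initial segments of the natural numbers. -/
structure DCA where
  numStates : ℕ
  numLetters : ℕ
  numStackSymbols : ℕ
  aut : DPDA (Fin numStates) (Fin numLetters) (Fin numStackSymbols)
  isDCA : aut.IsDCA

namespace DCA

/-- The finite description by which an automaton is given to an algorithm: the numbers of states,
letters and stack symbols, the bottom symbol, and the full transition table, whose entry number `x` in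
list number `a` in list number `q` is `δ q a x`. -/
def code (M : DCA) : ℕ × ℕ × ℕ × ℕ × List (List (List (ℕ × List ℕ))) :=
  (M.numStates, M.numLetters, M.numStackSymbols, M.aut.bot.val,
    List.ofFn fun q => List.ofFn fun a => List.ofFn fun x =>
      ((M.aut.δ q a x).1.val, (M.aut.δ q a x).2.map Fin.val))

/-- The description determines the automaton. -/
theorem code_injective : Function.Injective code := by
  rintro ⟨n, k, g, ⟨δ, b, h⟩, hM⟩ ⟨n', k', g', ⟨δ', b', h'⟩, hM'⟩ hc
  simp only [code, Prod.mk.injEq] at hc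
  obtain ⟨rfl, rfl, rfl, hb, hδ⟩ := hc
  obtain rfl := Fin.ext hb
  obtain rfl : δ = δ' := by
    funext q a x
    have h1 := congrFun (List.ofFn_injective (congrFun (List.ofFn_injective
      (congrFun (List.ofFn_injective hδ) q)) a)) x
    simp only [Prod.mk.injEq] at h1
    exact Prod.ext (Fin.ext h1.1) (List.map_injective_iff.2 Fin.val_injective h1.2)
  rfl

/-- A decision problem about deterministic one-counter automata is decidable if some algorithm answers
it correctly on the description of every such automaton (there is no requirement on inputs that
describe none). -/
def DecidableProblem (P : DCA → Prop) : Prop :=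
  ∃ R : ℕ × ℕ × ℕ × ℕ × List (List (List (ℕ × List ℕ))) → Prop,
    ComputablePred R ∧ ∀ M : DCA, R M.code ↔ P M

/-- Does some word synchronize the given automaton in the empty stack model? -/
def SyncEmpty (M : DCA) : Prop := ∃ w, M.aut.SynchronizesEmpty w

/-- Does some word synchronize the given automaton in the same stack model? -/
def SyncSame (M : DCA) : Prop := ∃ w, M.aut.SynchronizesSame w

/-- Does some word synchronize the given automaton in the arbitrary stack model? -/
def SyncArb (M : DCA) : Prop := ∃ w, M.aut.SynchronizesArb w

end DCA

/-! The proof reduces a halting problem for counter programs to synchronization. A counter program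
is a regular expression over the actions increment, decrement and zero test on finitely many
counters; it relates two stores when some word of its language can be executed from one to the
other.

Such programs are universal. By induction on `Nat.Partrec'`, the graph of every partial recursive
function can be tested by a nondeterministic program that guesses intermediate values, checks them
and erases them again (`Nat.Partrec'.testableFun`, resting on `Testable.exists_chain`). Hence some
fixed program `P`, started with `n` in counter `0`, halts exactly for `n` in an undecidable set, and
can then halt with all counters zero.

One counter suffices to follow `P` because synchronization runs an automaton from all its states in
parallel. Let `D` be a DFA for the language of `P`. The automaton has one copy for each counter `i`
of `P`; every copy runs `D` on the actions read, and copy `i` keeps counter `i` on its stack. The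
letter `start` initializes the copies, with `n` hard-wired into the table, and `finish` leads to an
absorbing state `final` if the stack shows the bottom symbol and `D` accepts. Any violation sends
the copy to an idle state with a nonempty counter, from which it can never leave the idle states.
Since `final` is absorbing, a synchronizing word must bring all copies there, so every action in it
was legal for every counter at once and a run of `P` is read off.

A halting run gives synchronization in the empty stack model, which implies the same stack model,
which implies the arbitrary one, and the last already gives back a halting run. So one reduction
serves all three models. -/

/-! ### Languages of regular expressions are regular -/

namespace Language

open scoped Computability

variable {α : Type}

/-- The cut between the two factors falls either after `w` or inside it. The second case is indexed
by a set of quotients of `M`, rather than by the splittings of `w`, so that only finitely many index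
sets occur when `M` is regular. -/
theorem leftQuotient_mul (L M : Language α) (w : List α) :
    (L * M).leftQuotient w = L.leftQuotient w * M +
      ⨆ A ∈ {A | ∃ u v, w = u ++ v ∧ u ∈ L ∧ A = M.leftQuotient v}, A := by
  ext y
  simp only [mem_leftQuotient, Language.mem_add, Language.mem_mul, Language.mem_iSup,
    Set.mem_ofPred_eq]
  constructor
  · rintro ⟨a, ha, b, hb, h⟩
    rcases List.append_eq_append_iff.1 h with ⟨c, rfl, rfl⟩ | ⟨c, rfl, rfl⟩
    · exact Or.inr ⟨_, ⟨a, c, rfl, ha, rfl⟩, hb⟩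
    · exact Or.inl ⟨c, ha, b, hb, rfl⟩
  · rintro (⟨c, hc, b, hb, rfl⟩ | ⟨_, ⟨u, v, rfl, hu, rfl⟩, hy⟩)
    · exact ⟨_, hc, b, hb, by simp⟩
    · exact ⟨u, hu, _, hy, by simp⟩

/-- Some factor straddles the end of `w`, or `w` ends exactly at a boundary between factors. -/
theorem leftQuotient_kstar (L : Language α) (w : List α) :
    (L∗).leftQuotient w =
      (⨆ A ∈ {A | ∃ u v, w = u ++ v ∧ u ∈ L∗ ∧ A = L.leftQuotient v}, A) * L∗ +
        ⨆ _ : w ∈ L∗, L∗ := by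
  ext y
  simp only [mem_leftQuotient, Language.mem_add, Language.mem_mul, Language.mem_iSup,
    Set.mem_ofPred_eq]
  constructor
  · intro h
    obtain ⟨F, hF, hL⟩ := Language.mem_kstar.1 h
    clear h
    induction F generalizing w with
    | nil =>
      obtain ⟨rfl, rfl⟩ := List.append_eq_nil_iff.1 hF
      exact Or.inr ⟨nil_mem_kstar L, nil_mem_kstar L⟩
    | cons f F ih =>
      have hf : f ∈ L := hL f (by simp)
      have hF' : ∀ x ∈ F, x ∈ L := fun x hx => hL x (by simp [hx])
      have cons_mem : ∀ u ∈ L∗, f ++ u ∈ L∗ := by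
        intro u hu
        obtain ⟨G, rfl, hG⟩ := Language.mem_kstar.1 hu
        exact Language.mem_kstar.2 ⟨f :: G, rfl, by simpa [hf] using hG⟩
      rw [List.flatten_cons] at hF
      rcases List.append_eq_append_iff.1 hF with ⟨c, rfl, rfl⟩ | ⟨c, rfl, hc⟩
      · exact Or.inl ⟨c, ⟨_, ⟨[], w, rfl, nil_mem_kstar L, rfl⟩, hf⟩, _,
          join_mem_kstar hF', rfl⟩
      · rcases ih c hc.symm hF' with ⟨a, ⟨_, ⟨u, v, rfl, hu, rfl⟩, ha⟩, b, hb, rfl⟩ | ⟨h1, h2⟩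
        · exact Or.inl ⟨a, ⟨_, ⟨f ++ u, v, by simp, cons_mem u hu, rfl⟩, ha⟩, b, hb, rfl⟩
        · exact Or.inr ⟨cons_mem _ h1, h2⟩
  · have app_mem : ∀ u ∈ L∗, ∀ v ∈ L∗, u ++ v ∈ L∗ := by
      intro u hu v hv
      have := Language.append_mem_mul hu hv
      rwa [kstar_mul_kstar] at this
    rintro (⟨a, ⟨_, ⟨u, v, rfl, hu, rfl⟩, ha⟩, b, hb, rfl⟩ | ⟨h1, h2⟩)
    · have h1 : v ++ a ∈ L∗ := by simpa using join_mem_kstar (L := [v ++ a]) (by simpa using ha)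
      simpa using app_mem _ hu _ (app_mem _ h1 _ hb)
    · exact app_mem _ h1 _ h2

/-- By Myhill–Nerode it suffices to count quotients: each is determined by a quotient of `L` and a
subset of the finite set of quotients of `M`. -/
theorem IsRegular.mul {L M : Language α} (hL : L.IsRegular) (hM : M.IsRegular) :
    (L * M).IsRegular := by
  rw [isRegular_iff_finite_range_leftQuotient] at *
  refine ((hL.prod hM.finite_subsets).image
    fun p => p.1 * M + ⨆ A ∈ p.2, A).subset ?_
  rintro _ ⟨w, rfl⟩
  refine ⟨(L.leftQuotient w, {A | ∃ u v, w = u ++ v ∧ u ∈ L ∧ A = M.leftQuotient v}),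
    ⟨⟨w, rfl⟩, ?_⟩, (leftQuotient_mul L M w).symm⟩
  rintro _ ⟨u, v, -, -, rfl⟩
  exact ⟨v, rfl⟩

theorem IsRegular.kstar {L : Language α} (hL : L.IsRegular) : (L∗).IsRegular := by
  rw [isRegular_iff_finite_range_leftQuotient] at *
  refine ((hL.finite_subsets.prod (Set.finite_univ (α := Prop))).image
    fun p => (⨆ A ∈ p.1, A) * L∗ + ⨆ _ : p.2, L∗).subset ?_
  rintro _ ⟨w, rfl⟩
  refine ⟨({A | ∃ u v, w = u ++ v ∧ u ∈ L∗ ∧ A = L.leftQuotient v}, w ∈ L∗),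
    ⟨?_, trivial⟩, (leftQuotient_kstar L w).symm⟩
  rintro _ ⟨u, v, -, -, rfl⟩
  exact ⟨v, rfl⟩

theorem IsRegular.of_length_le_one {L : Language α} (c : α → Prop) (e : Prop)
    (h : ∀ w, w ∈ L ↔ (w = [] ∧ e) ∨ ∃ a, w = [a] ∧ c a) : L.IsRegular := by
  rw [isRegular_iff_finite_range_leftQuotient]
  -- Quotient by the empty word, by one letter (`1` or `0`), and by a longer word (`0`).
  refine (Set.toFinite {L, 1, 0}).subset ?_
  rintro _ ⟨w, rfl⟩
  match w with
  | [] => exact Or.inl rfl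
  | [a] =>
    by_cases ha : c a
    · refine Or.inr (Or.inl ?_)
      ext y
      simp [h, ha, Language.mem_one]
    · refine Or.inr (Or.inr ?_)
      ext y
      simp [h, ha, Language.notMem_zero]
  | a :: b :: w =>
    refine Or.inr (Or.inr ?_)
    ext y
    simp [h, Language.notMem_zero]

end Language

theorem RegularExpression.isRegular_matches' {α : Type} (P : RegularExpression α) :
    P.matches'.IsRegular := by
  induction P with
  | zero => exact .of_length_le_one (fun _ => False) False (by
      simp [RegularExpression.matches', Language.notMem_zero])
  | epsilon => exact .of_length_le_one (fun _ => False) True (by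
      simp [RegularExpression.matches', Language.mem_one])
  | char a => exact .of_length_le_one (fun b => b = a) False (by
      simp only [RegularExpression.matches', and_false, false_or, exists_eq_right]
      exact fun w => Iff.rfl)
  | plus P Q hP hQ => exact hP.add hQ
  | comp P Q hP hQ => exact hP.mul hQ
  | star P hP => exact hP.kstar

/-! ### Counter programs and their input-output relations -/

/-- The three actions on a counter. -/
inductive CounterOp
  | inc
  | dec
  | zero

namespace CounterOp

instance : Finite CounterOp :=
  Finite.of_surjective (fun i : Fin 3 => ![inc, dec, zero] i) fun a => by
    cases a
    exacts [⟨0, rfl⟩, ⟨1, rfl⟩, ⟨2, rfl⟩]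

/-- The effect of an action on the value of the counter it is applied to. -/
def Act : CounterOp → ℕ → ℕ → Prop
  | inc, m, m' => m' = m + 1
  | dec, m, m' => m = m' + 1
  | zero, m, m' => m = 0 ∧ m' = 0

end CounterOp

/-- The effect on a store of applying an action to one counter. -/
def CounterStep (a : ℕ × CounterOp) (s s' : ℕ → ℕ) : Prop :=
  ∃ m, a.2.Act (s a.1) m ∧ s' = Function.update s a.1 m

/-- The effect on a store of a sequence of actions. -/
def CounterRun : List (ℕ × CounterOp) → (ℕ → ℕ) → (ℕ → ℕ) → Prop
  | [], s, s' => s' = s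
  | a :: w, s, s' => ∃ t, CounterStep a s t ∧ CounterRun w t s'

theorem counterRun_append (u v : List (ℕ × CounterOp)) (s s' : ℕ → ℕ) :
    CounterRun (u ++ v) s s' ↔ ∃ t, CounterRun u s t ∧ CounterRun v t s' := by
  induction u generalizing s with
  | nil => simp [CounterRun]
  | cons a u ih =>
    simp only [List.cons_append, CounterRun, ih]
    constructor
    · rintro ⟨t, h, t', h', h''⟩
      exact ⟨t', ⟨t, h, h'⟩, h''⟩
    · rintro ⟨t', ⟨t, h, h'⟩, h''⟩
      exact ⟨t, h, t', h', h''⟩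

/-- A nondeterministic counter program. -/
abbrev CounterProg := RegularExpression (ℕ × CounterOp)

namespace CounterProg

/-- The input-output relation of a counter program. -/
def Rel (P : CounterProg) (s s' : ℕ → ℕ) : Prop :=
  ∃ w ∈ P.matches', CounterRun w s s'

/-- The program that performs one action. -/
def op (r : ℕ) (a : CounterOp) : CounterProg := .char (r, a)

theorem rel_op (r : ℕ) (a : CounterOp) (s s' : ℕ → ℕ) :
    (op r a).Rel s s' ↔ ∃ m, a.Act (s r) m ∧ s' = Function.update s r m := by
  have : ∀ w : List (ℕ × CounterOp), w ∈ ({[(r, a)]} : Language _) ↔ w = [(r, a)] :=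
    fun w => Iff.rfl
  simp [Rel, op, RegularExpression.matches', this, CounterRun, CounterStep]

theorem rel_inc (r : ℕ) (s s' : ℕ → ℕ) :
    (op r .inc).Rel s s' ↔ s' = Function.update s r (s r + 1) := by
  simp [rel_op, CounterOp.Act]

theorem rel_dec (r : ℕ) (s s' : ℕ → ℕ) :
    (op r .dec).Rel s s' ↔ ∃ m, s r = m + 1 ∧ s' = Function.update s r m := by
  simp [rel_op, CounterOp.Act]

theorem rel_zero (r : ℕ) (s s' : ℕ → ℕ) :
    (op r .zero).Rel s s' ↔ s r = 0 ∧ s' = s := by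
  simp only [rel_op, CounterOp.Act]
  constructor
  · rintro ⟨m, ⟨h, rfl⟩, rfl⟩
    exact ⟨h, by rw [← h, Function.update_eq_self]⟩
  · rintro ⟨h, rfl⟩
    exact ⟨0, ⟨h, rfl⟩, by rw [← h, Function.update_eq_self]⟩

theorem rel_one (s s' : ℕ → ℕ) : Rel 1 s s' ↔ s' = s := by
  simp [Rel, Language.mem_one, CounterRun]

theorem rel_mul (P P' : CounterProg) (s s' : ℕ → ℕ) :
    Rel (P * P') s s' ↔ ∃ t, P.Rel s t ∧ P'.Rel t s' := by
  simp only [Rel, RegularExpression.matches'_mul, Language.mem_mul]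
  constructor
  · rintro ⟨_, ⟨u, hu, v, hv, rfl⟩, h⟩
    obtain ⟨t, h1, h2⟩ := (counterRun_append u v s s').1 h
    exact ⟨t, ⟨u, hu, h1⟩, v, hv, h2⟩
  · rintro ⟨t, ⟨u, hu, h1⟩, v, hv, h2⟩
    exact ⟨_, ⟨u, hu, v, hv, rfl⟩, (counterRun_append u v s s').2 ⟨t, h1, h2⟩⟩

/-- The program that repeats a program an arbitrary number of times. -/
def loop (P : CounterProg) : CounterProg := RegularExpression.star P

theorem rel_loop (P : CounterProg) (s s' : ℕ → ℕ) :
    (loop P).Rel s s' ↔ Relation.ReflTransGen P.Rel s s' := by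
  simp only [Rel, loop, RegularExpression.matches'_star, Language.mem_kstar]
  constructor
  · rintro ⟨_, ⟨F, rfl, hF⟩, h⟩
    induction F generalizing s with
    | nil => obtain rfl : s' = s := h; exact .refl
    | cons f F ih =>
      rw [List.flatten_cons, counterRun_append] at h
      obtain ⟨t, h1, h2⟩ := h
      exact .head ⟨f, hF f (by simp), h1⟩ (ih t (fun y hy => hF y (by simp [hy])) h2)
  · intro h
    induction h using Relation.ReflTransGen.head_induction_on with
    | refl => exact ⟨[], ⟨[], rfl, by simp⟩, rfl⟩
    | head h _ ih =>
      obtain ⟨_, ⟨F, rfl, hF⟩, h2⟩ := ih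
      obtain ⟨w, hw, h1⟩ := h
      exact ⟨_, ⟨w :: F, rfl, by simpa [hw] using hF⟩, by
        rw [List.flatten_cons, counterRun_append]; exact ⟨_, h1, h2⟩⟩

/-- Only finitely many counters occur, so the automaton needs only finitely many copies. -/
theorem exists_bound (P : CounterProg) : ∃ B, ∀ w ∈ P.matches', ∀ a ∈ w, a.1 < B := by
  induction P with
  | zero => exact ⟨0, fun w hw => absurd hw (Language.notMem_zero w)⟩
  | epsilon =>
    refine ⟨0, fun w hw => ?_⟩
    obtain rfl := Language.mem_one w |>.1 hw
    simp
  | char a =>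
    refine ⟨a.1 + 1, fun w hw => ?_⟩
    obtain rfl : w = [a] := hw
    simp
  | plus P Q hP hQ =>
    obtain ⟨B, hB⟩ := hP
    obtain ⟨C, hC⟩ := hQ
    refine ⟨max B C, fun w hw a ha => ?_⟩
    rcases hw with hw | hw
    · exact lt_max_of_lt_left (hB w hw a ha)
    · exact lt_max_of_lt_right (hC w hw a ha)
  | comp P Q hP hQ =>
    obtain ⟨B, hB⟩ := hP
    obtain ⟨C, hC⟩ := hQ
    refine ⟨max B C, fun w hw a ha => ?_⟩
    obtain ⟨u, hu, v, hv, rfl⟩ := Language.mem_mul.1 hw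
    rcases List.mem_append.1 ha with ha | ha
    · exact lt_max_of_lt_left (hB u hu a ha)
    · exact lt_max_of_lt_right (hC v hv a ha)
  | star P hP =>
    obtain ⟨B, hB⟩ := hP
    refine ⟨B, fun w hw a ha => ?_⟩
    obtain ⟨F, rfl, hF⟩ := Language.mem_kstar.1 hw
    obtain ⟨f, hf, ha⟩ := List.mem_flatten.1 ha
    exact hB f (hF f hf) a ha

/-- The program that sets a counter to an arbitrary value. -/
def havoc (r : ℕ) : CounterProg := loop (op r .dec) * loop (op r .inc)

theorem rel_loop_inc (r : ℕ) (s s' : ℕ → ℕ) :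
    (loop (op r .inc)).Rel s s' ↔ ∃ k, s' = Function.update s r (s r + k) := by
  rw [rel_loop]
  constructor
  · intro h
    induction h with
    | refl => exact ⟨0, by simp⟩
    | tail _ h ih =>
      obtain ⟨k, rfl⟩ := ih
      exact ⟨k + 1, by rw [(rel_inc _ _ _).1 h]; simp [add_assoc]⟩
  · rintro ⟨k, rfl⟩
    induction k with
    | zero => simpa using .refl
    | succ k ih => exact .tail ih ((rel_inc _ _ _).2 (by simp [add_assoc]))

theorem rel_loop_dec (r : ℕ) (s s' : ℕ → ℕ) :
    (loop (op r .dec)).Rel s s' ↔ ∃ k ≤ s r, s' = Function.update s r k := by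
  rw [rel_loop]
  constructor
  · intro h
    induction h with
    | refl => exact ⟨s r, le_rfl, by simp⟩
    | tail _ h ih =>
      obtain ⟨k, hk, rfl⟩ := ih
      obtain ⟨m, hm, rfl⟩ := (rel_dec _ _ _).1 h
      simp only [Function.update_self] at hm
      exact ⟨m, by omega, by simp⟩
  · rintro ⟨k, hk, rfl⟩
    induction hk using Nat.decreasingInduction with
    | self => simpa using .refl
    | of_succ k hk ih => exact .tail ih ((rel_dec _ _ _).2 ⟨k, by simp⟩)

theorem rel_havoc (r : ℕ) (s s' : ℕ → ℕ) :
    (havoc r).Rel s s' ↔ ∃ k, s' = Function.update s r k := by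
  simp only [havoc, rel_mul, rel_loop_inc, rel_loop_dec]
  constructor
  · rintro ⟨_, ⟨k, -, rfl⟩, m, rfl⟩
    exact ⟨k + m, by simp⟩
  · rintro ⟨k, rfl⟩
    exact ⟨_, ⟨0, by simp, rfl⟩, k, by simp⟩

/-- The program that sets a counter to zero. -/
def clear (r : ℕ) : CounterProg := havoc r * op r .zero

theorem rel_clear (r : ℕ) (s s' : ℕ → ℕ) :
    (clear r).Rel s s' ↔ s' = Function.update s r 0 := by
  simp only [clear, rel_mul, rel_havoc, rel_zero]
  constructor
  · rintro ⟨_, ⟨k, rfl⟩, h, rfl⟩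
    simp only [Function.update_self] at h
    rw [h]
  · rintro rfl
    exact ⟨_, ⟨0, rfl⟩, by simp, rfl⟩

/-- The program that tests two counters `i` and `j` for equality, using the counter `t`. -/
def testEq (i j t : ℕ) : CounterProg :=
  (loop (op i .dec * op j .dec * op t .inc)) * op i .zero * op j .zero *
    (loop (op t .dec * op i .inc * op j .inc)) * op t .zero

/-- The first loop moves a common amount `z` from `i` and `j` to `t`; both counters can reach zero
only if they were equal. The second loop restores them, and the last zero test forces it to run to
completion. -/
theorem rel_testEq {i j t : ℕ} (hij : i ≠ j) (hit : i ≠ t) (hjt : j ≠ t) {s : ℕ → ℕ}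
    (hs : s t = 0) (s' : ℕ → ℕ) : (testEq i j t).Rel s s' ↔ s i = s j ∧ s' = s := by
  -- All intermediate stores have this form, with invariants `x + z = s i` and `y + z = s j` on the
  -- way down.
  let st (x y z : ℕ) : ℕ → ℕ :=
    Function.update (Function.update (Function.update s i x) j y) t z
  have st_self : st (s i) (s j) 0 = s := by
    rw [← hs]; simp [st]
  have sti : ∀ x y z, st x y z i = x := by intros; simp [st, hij, hit]
  have stj : ∀ x y z, st x y z j = y := by intros; simp [st, hjt]
  have stt : ∀ x y z, st x y z t = z := by intros; simp [st]
  have ui : ∀ x y z m, Function.update (st x y z) i m = st m y z := by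
    intros; funext r; simp only [st, Function.update_apply]; split_ifs <;> simp_all
  have uj : ∀ x y z m, Function.update (st x y z) j m = st x m z := by
    intros; funext r; simp only [st, Function.update_apply]; split_ifs <;> simp_all
  have ut : ∀ x y z m, Function.update (st x y z) t m = st x y m := by
    intros; simp [st]
  have down : ∀ x y z τ, (op i .dec * op j .dec * op t .inc).Rel (st x y z) τ ↔
      ∃ x' y', x = x' + 1 ∧ y = y' + 1 ∧ τ = st x' y' (z + 1) := by
    intro x y z τ
    simp only [rel_mul, rel_dec, rel_inc]
    constructor
    · rintro ⟨_, ⟨_, ⟨m, hm, rfl⟩, m', hm', rfl⟩, rfl⟩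
      simp only [ui, uj, ut, sti, stj, stt] at hm hm' ⊢
      exact ⟨m, m', hm, hm', rfl⟩
    · rintro ⟨m, m', hm, hm', rfl⟩
      exact ⟨_, ⟨_, ⟨m, by rw [sti, hm], rfl⟩, m', by rw [ui, stj, hm'], rfl⟩,
        by simp only [ui, uj, ut, stt]⟩
  have up : ∀ x y z τ, (op t .dec * op i .inc * op j .inc).Rel (st x y z) τ ↔
      ∃ z', z = z' + 1 ∧ τ = st (x + 1) (y + 1) z' := by
    intro x y z τ
    simp only [rel_mul, rel_dec, rel_inc]
    constructor
    · rintro ⟨_, ⟨_, ⟨m, hm, rfl⟩, rfl⟩, rfl⟩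
      simp only [ui, uj, ut, sti, stj, stt] at hm ⊢
      exact ⟨m, hm, rfl⟩
    · rintro ⟨m, hm, rfl⟩
      exact ⟨_, ⟨_, ⟨m, by rw [stt, hm], rfl⟩, rfl⟩,
        by simp only [ui, uj, ut, sti, stj]⟩
  have downs : ∀ τ, (loop (op i .dec * op j .dec * op t .inc)).Rel s τ ↔
      ∃ x y z, x + z = s i ∧ y + z = s j ∧ τ = st x y z := by
    intro τ
    rw [rel_loop]
    constructor
    · intro h
      induction h with
      | refl => exact ⟨_, _, 0, rfl, rfl, st_self.symm⟩
      | tail _ h ih =>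
        obtain ⟨x, y, z, hx, hy, rfl⟩ := ih
        obtain ⟨x', y', rfl, rfl, rfl⟩ := (down _ _ _ _).1 h
        exact ⟨x', y', z + 1, by omega, by omega, rfl⟩
    · rintro ⟨x, y, z, hx, hy, rfl⟩
      induction z generalizing x y with
      | zero =>
        obtain rfl : x = s i := hx
        obtain rfl : y = s j := hy
        rw [st_self]
      | succ z ih =>
        exact .tail (ih (x + 1) (y + 1) (by omega) (by omega))
          ((down _ _ _ _).2 ⟨x, y, rfl, rfl, rfl⟩)
  have ups : ∀ n τ, (loop (op t .dec * op i .inc * op j .inc)).Rel (st 0 0 n) τ ↔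
      ∃ x z, x + z = n ∧ τ = st x x z := by
    intro n τ
    rw [rel_loop]
    constructor
    · intro h
      induction h with
      | refl => exact ⟨0, n, by omega, rfl⟩
      | tail _ h ih =>
        obtain ⟨x, z, hx, rfl⟩ := ih
        obtain ⟨z', rfl, rfl⟩ := (up _ _ _ _).1 h
        exact ⟨x + 1, z', by omega, rfl⟩
    · rintro ⟨x, z, hx, rfl⟩
      induction x generalizing z with
      | zero =>
        obtain rfl : z = n := by omega
        exact .refl
      | succ x ih => exact .tail (ih (z + 1) (by omega)) ((up _ _ _ _).2 ⟨z, rfl, rfl⟩)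
  simp only [testEq, rel_mul, rel_zero]
  constructor
  · rintro ⟨_, ⟨_, ⟨_, ⟨_, h, h0, rfl⟩, h1, rfl⟩, h2⟩, h3, rfl⟩
    obtain ⟨x, y, z, hx, hy, rfl⟩ := (downs _).1 h
    rw [sti] at h0
    rw [stj] at h1
    subst h0 h1
    obtain ⟨x, z', hx', rfl⟩ := (ups _ _).1 h2
    rw [stt] at h3
    subst h3
    have h1 : x = s i := by omega
    have h2 : x = s j := by omega
    refine ⟨by omega, ?_⟩
    conv_lhs => rw [h1]
    conv_rhs => rw [← st_self, ← h2, h1]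
  · rintro ⟨h, rfl⟩
    exact ⟨_, ⟨_, ⟨_, ⟨_, (downs _).2 ⟨0, 0, s' i, by omega, by omega, rfl⟩, sti _ _ _, rfl⟩,
      stj _ _ _, rfl⟩, (ups _ _).2 ⟨s' i, 0, rfl, rfl⟩⟩, stt _ _ _, by
        conv_lhs => rw [← st_self, ← h]⟩

end CounterProg

/-! ### Testable properties of stores; counters from `b` on are scratch space -/

/-- A property of stores that vanish from index `b` on is testable if some counter program runs
exactly on the stores that have it, and leaves them unchanged. -/
def Testable (b : ℕ) (T : (ℕ → ℕ) → Prop) : Prop :=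
  ∃ P : CounterProg, ∀ s : ℕ → ℕ, (∀ r, b ≤ r → s r = 0) → ∀ s', P.Rel s s' ↔ T s ∧ s' = s

namespace Testable

open CounterProg Function

variable {b : ℕ} {T U : (ℕ → ℕ) → Prop}

theorem congr (hT : Testable b T) (h : ∀ s : ℕ → ℕ, (∀ r, b ≤ r → s r = 0) → (U s ↔ T s)) :
    Testable b U := by
  obtain ⟨P, hP⟩ := hT
  exact ⟨P, fun s hs s' => by rw [hP s hs, h s hs]⟩

protected theorem true : Testable b fun _ => True :=
  ⟨1, fun s _ s' => by simp [rel_one]⟩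

protected theorem false : Testable b fun _ => False :=
  ⟨0, fun s _ s' => by simp [CounterProg.Rel, Language.notMem_zero]⟩

protected theorem and (hT : Testable b T) (hU : Testable b U) :
    Testable b fun s => T s ∧ U s := by
  obtain ⟨P, hP⟩ := hT
  obtain ⟨Q, hQ⟩ := hU
  refine ⟨P * Q, fun s hs s' => ?_⟩
  rw [rel_mul]
  constructor
  · rintro ⟨t, h1, h2⟩
    obtain ⟨h1, rfl⟩ := (hP s hs t).1 h1
    obtain ⟨h2, rfl⟩ := (hQ t hs s').1 h2
    exact ⟨⟨h1, h2⟩, rfl⟩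
  · rintro ⟨⟨h1, h2⟩, rfl⟩
    exact ⟨s', (hP _ hs _).2 ⟨h1, rfl⟩, (hQ _ hs _).2 ⟨h2, rfl⟩⟩

theorem forall_fin {m : ℕ} {T : Fin m → (ℕ → ℕ) → Prop} (h : ∀ i, Testable b (T i)) :
    Testable b fun s => ∀ i, T i s := by
  induction m with
  | zero => exact Testable.true.congr fun s _ => by simp
  | succ m ih =>
    exact ((h 0).and (ih fun i => h i.succ)).congr fun s _ => by rw [Fin.forall_fin_succ]

protected theorem eq {i j : ℕ} (hi : i < b) (hj : j < b) : Testable b fun s => s i = s j := by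
  by_cases hij : i = j
  · exact Testable.true.congr fun s _ => by simp [hij]
  · exact ⟨testEq i j b, fun s hs s' => rel_testEq hij hi.ne hj.ne (hs b le_rfl) s'⟩

theorem eq_zero (i : ℕ) : Testable b fun s => s i = 0 :=
  ⟨op i .zero, fun s _ s' => rel_zero i s s'⟩

theorem eq_succ {i j : ℕ} (hi : i < b) (hj : j < b) : Testable b fun s => s i = s j + 1 := by
  by_cases hij : i = j
  · exact Testable.false.congr fun s _ => by simp [hij]
  · refine ⟨op j .inc * testEq i j b * op j .dec, fun s hs s' => ?_⟩
    have hb : update s j (s j + 1) b = 0 := by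
      rw [update_of_ne hj.ne', hs b le_rfl]
    simp only [rel_mul, rel_inc, rel_dec]
    constructor
    · rintro ⟨_, ⟨_, rfl, h⟩, m, hm, rfl⟩
      obtain ⟨h', rfl⟩ := (rel_testEq hij hi.ne hj.ne hb _).1 h
      simp only [update_self, Nat.add_right_cancel_iff, update_of_ne hij] at h' hm
      subst hm
      exact ⟨h', by simp⟩
    · rintro ⟨h, rfl⟩
      exact ⟨_, ⟨_, rfl, (rel_testEq hij hi.ne hj.ne hb _).2
        ⟨by simp [update_of_ne hij, h], rfl⟩⟩, s' j, by simp, by simp⟩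

/-- Nondeterminism supplies the quantifier: guess the witness in counter `b`, test, and erase it. -/
theorem exists_nat (hT : Testable (b + 1) T) : Testable b fun s => ∃ y, T (update s b y) := by
  obtain ⟨P, hP⟩ := hT
  refine ⟨havoc b * P * clear b, fun s hs s' => ?_⟩
  have hs' : ∀ y r, b + 1 ≤ r → update s b y r = 0 := fun y r hr => by
    rw [update_of_ne (by omega), hs r (by omega)]
  have h0 : ∀ y, update (update s b y) b 0 = s := fun y => by
    rw [update_idem, ← hs b le_rfl, update_eq_self]
  simp only [rel_mul, rel_havoc, rel_clear]
  constructor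
  · rintro ⟨_, ⟨_, ⟨y, rfl⟩, h⟩, rfl⟩
    obtain ⟨h', rfl⟩ := (hP _ (hs' y) _).1 h
    exact ⟨⟨y, h'⟩, h0 y⟩
  · rintro ⟨⟨y, h⟩, rfl⟩
    exact ⟨_, ⟨_, ⟨y, rfl⟩, (hP _ (hs' y) _).2 ⟨h, rfl⟩⟩, (h0 y).symm⟩

theorem exists_store {m : ℕ} (hT : Testable (b + m) T) :
    Testable b fun s => ∃ t : ℕ → ℕ, (∀ r < b, t r = s r) ∧ (∀ r, b + m ≤ r → t r = 0) ∧ T t := by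
  induction m generalizing b with
  | zero =>
    refine hT.congr fun s hs => ⟨?_, fun h => ⟨s, fun _ _ => rfl, hs, h⟩⟩
    rintro ⟨t, h1, h2, h⟩
    have : t = s := by
      funext r
      rcases lt_or_ge r b with hr | hr
      · exact h1 r hr
      · rw [h2 r hr, hs r hr]
    exact this ▸ h
  | succ m ih =>
    rw [show b + (m + 1) = b + 1 + m by omega] at hT ⊢
    refine (ih hT).exists_nat.congr fun s hs => ?_
    constructor
    · rintro ⟨t, h1, h2, h⟩
      refine ⟨t b, t, fun r hr => ?_, h2, h⟩
      rcases eq_or_ne r b with rfl | hrb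
      · simp
      · rw [update_of_ne hrb, h1 r (by omega)]
    · rintro ⟨y, t, h1, h2, h⟩
      refine ⟨t, fun r hr => ?_, h2, h⟩
      rw [h1 r (by omega), update_of_ne hr.ne]

theorem ne_zero {i : ℕ} (hi : i < b) : Testable b fun s => s i ≠ 0 := by
  refine (eq_succ (b := b + 1) (i := i) (j := b) (by omega) (by omega)).exists_nat.congr
    fun s _ => ?_
  simp only [update_of_ne hi.ne, update_self]
  exact ⟨Nat.exists_eq_succ_of_ne_zero, by rintro ⟨y, h⟩; omega⟩

/-- The store obtained by writing three values from index `b` on. -/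
def _root_.writeThree (s : ℕ → ℕ) (b k x y : ℕ) : ℕ → ℕ :=
  update (update (update s b k) (b + 1) x) (b + 2) y

section writeThree

variable (s : ℕ → ℕ) (k x y m : ℕ)

theorem _root_.writeThree_apply_zero : writeThree s b k x y b = k := by
  simp [writeThree]

theorem _root_.writeThree_apply_one : writeThree s b k x y (b + 1) = x := by
  simp [writeThree]

theorem _root_.writeThree_apply_two : writeThree s b k x y (b + 2) = y := by
  simp [writeThree]

theorem _root_.writeThree_apply_of_lt {r : ℕ} (hr : r < b) : writeThree s b k x y r = s r := by
  rw [writeThree, update_of_ne (by omega), update_of_ne (by omega), update_of_ne (by omega)]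

theorem _root_.writeThree_apply_of_ge {r : ℕ} (hr : b + 3 ≤ r) :
    writeThree s b k x y r = s r := by
  rw [writeThree, update_of_ne (by omega), update_of_ne (by omega), update_of_ne (by omega)]

theorem _root_.update_writeThree_zero :
    update (writeThree s b k x y) b m = writeThree s b m x y := by
  funext r; simp only [writeThree, update_apply]; split_ifs <;> simp_all

theorem _root_.update_writeThree_one :
    update (writeThree s b k x y) (b + 1) m = writeThree s b k m y := by
  funext r; simp only [writeThree, update_apply]; split_ifs <;> simp_all

theorem _root_.update_writeThree_two :
    update (writeThree s b k x y) (b + 2) m = writeThree s b k x m := by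
  simp [writeThree]

end writeThree

/-- This turns iteration into a loop that guesses a finite sequence one term at a time. Counter `b`
holds the index, `b + 1` the current term, `b + 2` the next one; only two consecutive terms are ever
stored. -/
theorem exists_chain {I S F : (ℕ → ℕ) → Prop} (hI : Testable (b + 3) I) (hS : Testable (b + 3) S)
    (hF : Testable (b + 3) F) :
    Testable b fun s => ∃ (k : ℕ) (a : ℕ → ℕ), I (writeThree s b 0 (a 0) 0) ∧
      (∀ j < k, S (writeThree s b j (a j) (a (j + 1)))) ∧ F (writeThree s b k (a k) 0) := by
  obtain ⟨P, hP⟩ := hI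
  obtain ⟨Q, hQ⟩ := hS
  obtain ⟨R, hR⟩ := hF
  -- After the check of the guessed next term, it is copied to `b + 1` by guessing a value there and
  -- testing equality, with `b + 3` as scratch.
  let body : CounterProg := havoc (b + 2) * Q * havoc (b + 1) * testEq (b + 1) (b + 2) (b + 3) *
    clear (b + 2) * op b .inc
  refine ⟨havoc (b + 1) * P * loop body * R * clear b * clear (b + 1), fun s hs s' => ?_⟩
  have hz : ∀ k x y r, b + 3 ≤ r → writeThree s b k x y r = 0 := fun k x y r hr => by
    rw [writeThree_apply_of_ge s k x y hr, hs r (by omega)]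
  have h0 : writeThree s b 0 0 0 = s := by
    funext r
    rcases lt_or_ge r b with hr | hr
    · rw [writeThree_apply_of_lt _ _ _ _ hr]
    · rw [hs r hr]
      simp only [writeThree, update_apply, hs r hr, ite_self]
  have hbody : ∀ k x t, body.Rel (writeThree s b k x 0) t ↔
      ∃ y, S (writeThree s b k x y) ∧ t = writeThree s b (k + 1) y 0 := by
    intro k x t
    simp only [body, rel_mul, rel_havoc, rel_clear, rel_inc]
    constructor
    · rintro ⟨_, ⟨_, ⟨_, ⟨_, ⟨_, ⟨y, rfl⟩, h⟩, x', rfl⟩, h'⟩, rfl⟩, rfl⟩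
      rw [update_writeThree_two] at h
      obtain ⟨hS, rfl⟩ := (hQ _ (hz _ _ _) _).1 h
      rw [update_writeThree_one] at h'
      obtain ⟨hx, rfl⟩ := (rel_testEq (by omega) (by omega) (by omega) (hz _ _ _ _ le_rfl) _).1 h'
      rw [writeThree_apply_one, writeThree_apply_two] at hx
      subst hx
      exact ⟨x', hS, by
        simp only [update_writeThree_two, update_writeThree_zero, writeThree_apply_zero]⟩
    · rintro ⟨y, h, rfl⟩
      refine ⟨_, ⟨writeThree s b k y y, ⟨_, ⟨writeThree s b k x y, ⟨_, ⟨y, rfl⟩, ?_⟩, y, rfl⟩,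
        ?_⟩, rfl⟩, ?_⟩
      · rw [update_writeThree_two]
        exact (hQ _ (hz _ _ _) _).2 ⟨h, rfl⟩
      · rw [update_writeThree_one]
        exact (rel_testEq (by omega) (by omega) (by omega) (hz _ _ _ _ le_rfl) _).2
          ⟨by rw [writeThree_apply_one, writeThree_apply_two], rfl⟩
      · simp only [update_writeThree_two, update_writeThree_zero, writeThree_apply_zero]
  have hloop : ∀ x t, (loop body).Rel (writeThree s b 0 x 0) t ↔ ∃ (k : ℕ) (a : ℕ → ℕ), a 0 = x ∧
      (∀ j < k, S (writeThree s b j (a j) (a (j + 1)))) ∧ t = writeThree s b k (a k) 0 := by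
    intro x t
    rw [rel_loop]
    constructor
    · intro h
      induction h with
      | refl => exact ⟨0, fun _ => x, rfl, by simp, rfl⟩
      | tail _ h ih =>
        obtain ⟨k, a, h1, h2, rfl⟩ := ih
        obtain ⟨y, hy, rfl⟩ := (hbody _ _ _).1 h
        refine ⟨k + 1, update a (k + 1) y, by simp [h1], fun j hj => ?_, by simp⟩
        rw [update_of_ne (by omega : j ≠ k + 1)]
        rcases eq_or_ne j k with rfl | hjk
        · simpa using hy
        · rw [update_of_ne (by omega)]
          exact h2 j (by omega)
    · rintro ⟨k, a, rfl, h, rfl⟩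
      induction k with
      | zero => exact .refl
      | succ k ih =>
        exact .tail (ih fun j hj => h j (by omega)) ((hbody _ _ _).2 ⟨_, h k (by omega), rfl⟩)
  have hstart : ∀ x, update s (b + 1) x = writeThree s b 0 x 0 := fun x => by
    conv_lhs => rw [← h0]
    rw [update_writeThree_one]
  simp only [rel_mul, rel_havoc, rel_clear]
  constructor
  · rintro ⟨_, ⟨_, ⟨_, ⟨_, ⟨_, ⟨x, rfl⟩, h1⟩, h2⟩, h3⟩, rfl⟩, rfl⟩
    rw [hstart] at h1
    obtain ⟨hI, rfl⟩ := (hP _ (hz _ _ _) _).1 h1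
    obtain ⟨k, a, rfl, hS, rfl⟩ := (hloop _ _).1 h2
    obtain ⟨hF, rfl⟩ := (hR _ (hz _ _ _) _).1 h3
    exact ⟨⟨k, a, hI, hS, hF⟩, by rw [update_writeThree_zero, update_writeThree_one, h0]⟩
  · rintro ⟨⟨k, a, h1, h2, h3⟩, rfl⟩
    refine ⟨_, ⟨_, ⟨_, ⟨_, ⟨_, ⟨a 0, rfl⟩, ?_⟩, (hloop _ _).2 ⟨k, a, rfl, h2, rfl⟩⟩,
      (hR _ (hz _ _ _) _).2 ⟨h3, rfl⟩⟩, rfl⟩, ?_⟩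
    · rw [hstart]
      exact (hP _ (hz _ _ _) _).2 ⟨h1, rfl⟩
    · rw [update_writeThree_zero, update_writeThree_one, h0]

end Testable

/-! ### Graphs of partial recursive functions are testable -/

/-- A partial function on vectors is testable if its graph is, for every choice of the counters that
hold the arguments and the value. -/
def TestableFun {n : ℕ} (f : List.Vector ℕ n →. ℕ) : Prop :=
  ∀ (ins : Fin n → ℕ) (out b : ℕ), (∀ i, ins i < b) → out < b →
    Testable b fun s => s out ∈ f (List.Vector.ofFn fun i => s (ins i))

namespace TestableFun

open Testable

theorem _root_.List.Vector.mem_mOfFn_part {n : ℕ} (g : Fin n → Part ℕ) (v : List.Vector ℕ n) :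
    v ∈ List.Vector.mOfFn g ↔ ∀ i, v.get i ∈ g i := by
  induction n with
  | zero => simp [List.Vector.mOfFn, List.Vector.eq_nil v]
  | succ n ih =>
    obtain ⟨a, v, rfl⟩ := v.exists_eq_cons
    simp only [List.Vector.mOfFn, Part.bind_eq_bind, Part.mem_bind_iff, Part.pure_eq_some,
      Part.mem_some_iff, ih, Fin.forall_fin_succ, List.Vector.get_zero, List.Vector.head_cons,
      List.Vector.get_cons_succ]
    constructor
    · rintro ⟨a', h1, v', h2, h⟩
      obtain ⟨rfl, rfl⟩ : a = a' ∧ v = v' :=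
        ⟨by simpa using congrArg List.Vector.head h, by simpa using congrArg List.Vector.tail h⟩
      exact ⟨h1, h2⟩
    · rintro ⟨h1, h2⟩
      exact ⟨a, h1, v, h2, rfl⟩

/-- The `m` inner values are guessed in fresh counters `b, …, b + m - 1`. -/
theorem comp {m n : ℕ} {f : List.Vector ℕ m →. ℕ} {g : Fin m → List.Vector ℕ n →. ℕ}
    (hf : TestableFun f) (hg : ∀ i, TestableFun (g i)) :
    TestableFun fun v => (List.Vector.mOfFn fun i => g i v) >>= f := by
  intro ins out b hins hout
  refine ((forall_fin fun i : Fin m => hg i ins (b + i) (b + m) (fun j => by have := hins j; omega)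
    (by omega)).and (hf (fun i => b + i) out (b + m) (by omega) (by omega))).exists_store.congr
    fun s hs => ?_
  refine Part.mem_bind_iff.trans ?_
  constructor
  · rintro ⟨v, h1, h2⟩
    rw [List.Vector.mem_mOfFn_part] at h1
    let t : ℕ → ℕ := fun r => if r < b then s r else if h : r - b < m then v.get ⟨r - b, h⟩ else 0
    have htb : ∀ r < b, t r = s r := fun r hr => by simp [t, hr]
    have htv : ∀ i : Fin m, t (b + i) = v.get i := fun i => by simp [t]
    refine ⟨t, htb, fun r hr => ?_, fun i => ?_, ?_⟩
    · simp only [t]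
      rw [if_neg (by omega), dif_neg (by omega)]
    · simp only [htv, htb _ (hins _)]
      exact h1 i
    · simp only [htv, htb _ hout, List.Vector.ofFn_get]
      exact h2
  · rintro ⟨t, htb, -, h1, h2⟩
    simp only [htb _ (hins _)] at h1
    rw [htb _ hout] at h2
    exact ⟨_, (List.Vector.mem_mOfFn_part _ _).2 fun i => by simpa using h1 i, h2⟩

/-- The chain consists of the successive values of the recursion; its length is compared with the
recursion argument and its last term with the output. -/
theorem prec {n : ℕ} {f : List.Vector ℕ n → ℕ} {g : List.Vector ℕ (n + 2) → ℕ}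
    (hf : TestableFun (f : List.Vector ℕ n →. ℕ))
    (hg : TestableFun (g : List.Vector ℕ (n + 2) →. ℕ)) :
    TestableFun ((fun v : List.Vector ℕ (n + 1) =>
      v.head.rec (f v.tail) fun y IH => g (y ::ᵥ IH ::ᵥ v.tail) : List.Vector ℕ (n + 1) → ℕ) :
        List.Vector ℕ (n + 1) →. ℕ) := by
  intro ins out b hins hout
  have hins' : ∀ i, ins i < b + 3 := fun i => by have := hins i; omega
  refine (exists_chain (hf (fun i => ins i.succ) (b + 1) (b + 3) (fun i => hins' _) (by omega))
    (hg (Fin.cons b (Fin.cons (b + 1) fun i => ins i.succ)) (b + 2) (b + 3)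
      (Fin.cases (by simp) (Fin.cases (by simp) fun i => by simpa using hins' _)) (by omega))
    ((Testable.eq (i := b) (j := ins 0) (by omega) (hins' 0)).and
      (Testable.eq (i := out) (j := b + 1) (by omega) (by omega)))).congr fun s hs => ?_
  have hv : ∀ k x y, (List.Vector.ofFn fun i => writeThree s b k x y
      ((Fin.cons b (Fin.cons (b + 1) fun i : Fin n => ins i.succ) : Fin (n + 2) → ℕ) i)) =
      k ::ᵥ x ::ᵥ List.Vector.ofFn fun i : Fin n => s (ins i.succ) := by
    intro k x y
    simp only [List.Vector.ofFn, Fin.cons_zero, Fin.cons_succ, writeThree_apply_zero,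
      writeThree_apply_one, writeThree_apply_of_lt _ _ _ _ (hins _)]
  simp only [hv, writeThree_apply_zero, writeThree_apply_one, writeThree_apply_two,
    writeThree_apply_of_lt _ _ _ _ (hins _), writeThree_apply_of_lt _ _ _ _ hout,
    PFun.coe_val, Part.mem_some_iff]
  simp only [List.Vector.ofFn, List.Vector.head_cons, List.Vector.tail_cons]
  constructor
  · intro h
    exact ⟨s (ins 0), fun j => j.rec (f (List.Vector.ofFn fun i => s (ins i.succ)))
      fun y IH => g (y ::ᵥ IH ::ᵥ List.Vector.ofFn fun i => s (ins i.succ)), rfl,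
      fun j _ => rfl, rfl, h⟩
  · rintro ⟨_, a, h0, h1, rfl, h2⟩
    rw [h2]
    generalize s (ins 0) = k at h1
    induction k with
    | zero => exact h0
    | succ k ih =>
      rw [h1 k (by omega), ih fun j hj => h1 j (by omega)]

/-- The chain certifies that `f` is nonzero at every index below its length. The final condition
reads the third slot, which then holds `0`, and so says that `f` vanishes at the length. -/
theorem rfind {n : ℕ} {f : List.Vector ℕ (n + 1) → ℕ}
    (hf : TestableFun (f : List.Vector ℕ (n + 1) →. ℕ)) :
    TestableFun fun v : List.Vector ℕ n => Nat.rfind fun k => Part.some (f (k ::ᵥ v) = 0) := by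
  intro ins out b hins hout
  have hins' : ∀ i, ins i < b + 3 := fun i => by have := hins i; omega
  have hf' := hf (Fin.cons b ins) (b + 2) (b + 3)
    (Fin.cases (by simp) fun i => by simpa using hins' _) (by omega)
  refine (exists_chain Testable.true
    (hf'.and (Testable.ne_zero (i := b + 2) (by omega)))
    (hf'.and (Testable.eq (i := out) (j := b) (by omega) (by omega)))).congr fun s hs => ?_
  have hv : ∀ k x y, (List.Vector.ofFn fun i => writeThree s b k x y
      ((Fin.cons b ins : Fin (n + 1) → ℕ) i)) = k ::ᵥ List.Vector.ofFn fun i => s (ins i) := by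
    intro k x y
    simp only [List.Vector.ofFn, Fin.cons_zero, Fin.cons_succ, writeThree_apply_zero,
      writeThree_apply_of_lt _ _ _ _ (hins _)]
  simp only [hv, writeThree_apply_zero, writeThree_apply_two,
    writeThree_apply_of_lt _ _ _ _ hout, PFun.coe_val, Part.mem_some_iff, true_and]
  refine Nat.mem_rfind.trans ?_
  simp only [Part.mem_some_iff]
  constructor
  · rintro ⟨h1, h2⟩
    -- Step `j` puts the value of `f` at `j` into term `j + 1`, hence the shift; term `0` is
    -- irrelevant.
    refine ⟨s out, fun j => f ((j - 1) ::ᵥ List.Vector.ofFn fun i => s (ins i)),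
      fun j hj => ?_, ?_⟩
    · have := h2 hj
      simp_all
    · simp_all
  · rintro ⟨_, a, h1, h2, rfl⟩
    refine ⟨by simp [← h2], fun {m} hm => ?_⟩
    obtain ⟨h3, h4⟩ := h1 m hm
    rw [h3] at h4
    simpa using h4

end TestableFun

theorem Nat.Primrec'.testableFun {n : ℕ} {f : List.Vector ℕ n → ℕ} (hf : Nat.Primrec' f) :
    TestableFun (f : List.Vector ℕ n →. ℕ) := by
  induction hf with
  | zero =>
    intro ins out b hins hout
    exact (Testable.eq_zero out).congr fun s _ => by simp
  | succ =>
    intro ins out b hins hout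
    exact (Testable.eq_succ hout (hins 0)).congr fun s _ => by
      simp [List.Vector.ofFn]
  | get i =>
    intro ins out b hins hout
    exact (Testable.eq hout (hins i)).congr fun s _ => by simp
  | comp g _ _ hf hg =>
    have := hf.comp hg
    intro ins out b hins hout
    refine (this ins out b hins hout).congr fun s _ => ?_
    refine Iff.trans ?_ Part.mem_bind_iff.symm
    simp
  | prec _ _ hf hg => exact hf.prec hg

theorem Nat.Partrec'.testableFun {n : ℕ} {f : List.Vector ℕ n →. ℕ} (hf : Nat.Partrec' f) :
    TestableFun f := by
  induction hf with
  | prim h => exact h.testableFun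
  | comp g _ _ hf hg => exact hf.comp hg
  | rfind _ hf => exact hf.rfind

/-! ### A counter program with an undecidable halting problem -/

/-- The store that holds `n` in counter `0`. -/
def initStore (n r : ℕ) : ℕ :=
  if r = 0 then n else 0

/-- A test preserves the store, so clearing counter `0` afterwards leaves every counter zero, as the
letter `finish` will require. -/
theorem Testable.exists_prog {T : (ℕ → ℕ) → Prop} (hT : Testable 1 T) :
    ∃ P : CounterProg, (∀ n s', P.Rel (initStore n) s' → T (initStore n)) ∧
      ∀ n, T (initStore n) → P.Rel (initStore n) 0 := by
  obtain ⟨P, hP⟩ := hT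
  have hz : ∀ n r, 1 ≤ r → initStore n r = 0 := fun n r hr => if_neg (by omega)
  refine ⟨P * .clear 0, fun n s' h => ?_, fun n h => ?_⟩
  · obtain ⟨t, h1, -⟩ := (CounterProg.rel_mul _ _ _ _).1 h
    exact ((hP _ (hz n) _).1 h1).1
  · refine (CounterProg.rel_mul _ _ _ _).2 ⟨_, (hP _ (hz n) _).2 ⟨h, rfl⟩, ?_⟩
    rw [CounterProg.rel_clear]
    funext r
    rcases eq_or_ne r 0 with rfl | hr
    · simp
    · simp [initStore, hr]

/-- There is a counter program with an undecidable halting problem. -/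
theorem exists_counterProg_not_computablePred : ∃ (p : ℕ → Prop) (P : CounterProg),
    ¬ ComputablePred p ∧ (∀ n s', P.Rel (initStore n) s' → p n) ∧
      ∀ n, p n → P.Rel (initStore n) 0 := by
  let f : ℕ →. ℕ := fun m => (Denumerable.ofNat Nat.Partrec.Code m).eval 0
  have hf : Partrec f := Nat.Partrec.Code.eval_part.comp (Computable.ofNat _) (Computable.const 0)
  have hf' := (Nat.Partrec'.part_iff₁.2 hf).testableFun
  have hT : Testable 1 fun s => (f (s 0)).Dom := by
    refine (hf' (fun _ => 0) 1 2 (by simp) (by simp)).exists_nat.congr fun s _ => ?_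
    simp [Part.dom_iff_mem, List.Vector.ofFn]
  obtain ⟨P, h1, h2⟩ := hT.exists_prog
  refine ⟨fun n => (f n).Dom, P, fun h => ?_, h1, h2⟩
  refine ComputablePred.halting_problem 0 ?_
  obtain ⟨_, h⟩ := h
  have h' : ComputablePred fun c : Nat.Partrec.Code => (f (Encodable.encode c)).Dom :=
    ⟨fun c => inferInstance, h.comp Computable.encode⟩
  refine h'.of_eq fun c => ?_
  change ((Denumerable.ofNat Nat.Partrec.Code (Encodable.encode c)).eval 0).Dom ↔ _
  rw [Denumerable.ofNat_encode]

/-! ### Renaming states and letters; comparison of the stack models -/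

namespace DPDA

variable {Q Q' A A' S : Type}

/-- Renaming the states and the letters of an automaton. -/
def reindex (M : DPDA Q A S) (e : Q ≃ Q') (e' : A ≃ A') : DPDA Q' A' S where
  δ q a x := (e (M.δ (e.symm q) (e'.symm a) x).1, (M.δ (e.symm q) (e'.symm a) x).2)
  bot := M.bot
  bot_lowest _ _ _ h := M.bot_lowest _ _ _ h

theorem run_reindex (M : DPDA Q A S) (e : Q ≃ Q') (e' : A ≃ A') (w : List A')
    (c d : Q' × List S) : (M.reindex e e').Run w c d ↔
      M.Run (w.map e'.symm) (e.symm c.1, c.2) (e.symm d.1, d.2) := by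
  induction w generalizing c with
  | nil => simp [Run, Prod.ext_iff]
  | cons a w ih =>
    simp only [Run, List.map_cons, ih]
    constructor
    · rintro ⟨_, ⟨u, x, h, rfl⟩, h'⟩
      exact ⟨_, ⟨u, x, h, rfl⟩, by simpa [reindex] using h'⟩
    · rintro ⟨_, ⟨u, x, h, rfl⟩, h'⟩
      exact ⟨_, ⟨u, x, h, rfl⟩, by simpa [reindex] using h'⟩

theorem run_append (M : DPDA Q A S) (u v : List A) (c d e : Q × List S) (h : M.Run u c d)
    (h' : M.Run v d e) : M.Run (u ++ v) c e := by
  induction u generalizing c with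
  | nil => obtain rfl : c = d := h; exact h'
  | cons a u ih =>
    obtain ⟨c', h1, h2⟩ := h
    exact ⟨c', h1, ih c' h2⟩

theorem SynchronizesEmpty.same {M : DPDA Q A S} {w : List A} (h : M.SynchronizesEmpty w) :
    M.SynchronizesSame w :=
  h.imp fun _ h => ⟨_, h⟩

theorem SynchronizesSame.arb {M : DPDA Q A S} {w : List A} (h : M.SynchronizesSame w) :
    M.SynchronizesArb w := by
  obtain ⟨p, v, h⟩ := h
  exact ⟨p, fun q => ⟨v, h q⟩⟩

theorem synchronizesEmpty_reindex {M : DPDA Q A S} (e : Q ≃ Q') (e' : A ≃ A') {w : List A}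
    (h : M.SynchronizesEmpty w) : (M.reindex e e').SynchronizesEmpty (w.map e') := by
  obtain ⟨p, h⟩ := h
  refine ⟨e p, fun q => (run_reindex _ _ _ _ _ _).2 ?_⟩
  simpa [reindex] using h (e.symm q)

theorem synchronizesArb_of_reindex {M : DPDA Q A S} (e : Q ≃ Q') (e' : A ≃ A') {w : List A'}
    (h : (M.reindex e e').SynchronizesArb w) : M.SynchronizesArb (w.map e'.symm) := by
  obtain ⟨p, h⟩ := h
  refine ⟨e.symm p, fun q => ?_⟩
  obtain ⟨v, hv⟩ := h (e q)
  exact ⟨v, by simpa [reindex] using (run_reindex _ _ _ _ _ _).1 hv⟩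

end DPDA

/-! ### The simulating one-counter automaton -/

/-- Letters of the automaton that simulates a counter program with `B` counters. -/
inductive SimLetter (B : ℕ)
  | start
  | finish
  | act (i : Fin B) (a : CounterOp)

/-- States of the automaton that simulates a counter program with `B` counters. -/
inductive SimState (B : ℕ) (σ : Type)
  | final
  | idle (i : Fin B)
  | live (i : Fin B) (s : σ)

instance (B : ℕ) : Finite (SimLetter B) :=
  Finite.of_surjective (fun x : Bool ⊕ Fin B × CounterOp => match x with
    | .inl b => if b then .start else .finish
    | .inr p => SimLetter.act p.1 p.2) fun a => by
    cases a with
    | start => exact ⟨.inl true, rfl⟩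
    | finish => exact ⟨.inl false, rfl⟩
    | act i a => exact ⟨.inr (i, a), rfl⟩

instance (B : ℕ) (σ : Type) [Finite σ] : Finite (SimState B σ) :=
  Finite.of_surjective (fun x : Unit ⊕ Fin B ⊕ Fin B × σ => match x with
    | .inl _ => .final
    | .inr (.inl i) => .idle i
    | .inr (.inr p) => SimState.live p.1 p.2) fun a => by
    cases a with
    | final => exact ⟨.inl (), rfl⟩
    | idle i => exact ⟨.inr (.inl i), rfl⟩
    | live i s => exact ⟨.inr (.inr (i, s)), rfl⟩

/-- The stack content that represents the value `c` of a counter. -/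
def counterStack (c : ℕ) : List (Fin 2) :=
  0 :: List.replicate c 1

theorem counterStack_succ (c : ℕ) : counterStack (c + 1) = counterStack c ++ [1] := by
  rw [counterStack, counterStack, List.replicate_succ', List.cons_append]

/-- What an action on a counter writes in place of the top stack symbol, if it is possible. -/
def CounterOp.write : CounterOp → Fin 2 → Option (List (Fin 2))
  | inc, x => some [x, 1]
  | dec, x => if x = 0 then none else some []
  | zero, x => if x = 0 then some [0] else none

section Simulation

variable {B : ℕ} {σ : Type} (D : DFA (ℕ × CounterOp) σ) (n : ℕ)

open Classical in
/-- The transition function of the simulating automaton: the states `live i s` keep track of the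
state `s` of `D` and, on the stack, of counter `i`. -/
noncomputable def simδ : SimState B σ → SimLetter B → Fin 2 → SimState B σ × List (Fin 2)
  | .final, _, x => (.final, [x])
  | .idle i, .start, x =>
    if x = 0 then (.live i D.start, counterStack (initStore n i)) else (.idle i, [x, 1])
  | .idle i, .finish, x => (.idle i, [x, 1])
  | .idle i, .act _ _, x => (.idle i, [x, 1])
  | .live i _, .start, x =>
    if x = 0 then (.live i D.start, counterStack (initStore n i)) else (.idle i, [x, 1])
  | .live i s, .finish, x =>
    if x = 0 ∧ s ∈ D.accept then (.final, [0]) else (.idle i, [x, 1])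
  | .live i s, .act j a, x =>
    if i = j then
      match a.write x with
      | some l => (.live i (D.step s (j, a)), l)
      | none => (.idle i, [x, 1])
    else (.live i (D.step s (j, a)), [x])

/-- The simulating automaton. -/
noncomputable def simDPDA : DPDA (SimState B σ) (SimLetter B) (Fin 2) where
  δ := simδ D n
  bot := 0
  bot_lowest q a x h := by
    -- Every word written by the automaton has one of these four shapes.
    have key : ∀ l : List (Fin 2), (l = [] ∨ l = [x] ∨ l = [x, 1] ∨
        (x = 0 ∧ ∃ m, l = counterStack m)) → 0 ∈ l → x = 0 ∧ ∃ v, l = 0 :: v ∧ 0 ∉ v := by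
      rintro l (rfl | rfl | rfl | ⟨rfl, m, rfl⟩) hl
      · simp at hl
      · obtain rfl : x = 0 := by simpa [eq_comm] using hl
        exact ⟨rfl, [], rfl, by simp⟩
      · obtain rfl : x = 0 := by simpa [eq_comm] using hl
        exact ⟨rfl, [1], rfl, by simp⟩
      · exact ⟨rfl, _, rfl, by simp [List.mem_replicate]⟩
    refine key _ ?_ h
    rcases q with _ | i | ⟨i, s⟩ <;> rcases a with _ | _ | ⟨j, a⟩
    case live.act =>
      rcases a <;> simp only [simδ, CounterOp.write] <;> split_ifs <;> simp_all
    all_goals simp only [simδ]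
    all_goals first | (split_ifs <;> simp_all) | simp

variable {D n}

theorem step_counterStack_zero {q : SimState B σ} {a : SimLetter B} {d : SimState B σ × _} :
    (simDPDA D n).Step a (q, counterStack 0) d ↔ d = simδ D n q a 0 := by
  constructor
  · rintro ⟨u, x, h, rfl⟩
    obtain ⟨rfl, rfl⟩ : u = [] ∧ 0 = x := by
      simpa [counterStack] using List.append_inj' (s₁ := []) (t₁ := [0]) h rfl |>.imp Eq.symm id
    rfl
  · rintro rfl
    exact ⟨[], 0, rfl, rfl⟩

theorem step_append_one {q : SimState B σ} {u : List (Fin 2)} {a : SimLetter B}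
    {d : SimState B σ × _} :
    (simDPDA D n).Step a (q, u ++ [1]) d ↔ d = ((simδ D n q a 1).1, u ++ (simδ D n q a 1).2) := by
  constructor
  · rintro ⟨u', x, h, rfl⟩
    obtain ⟨rfl, h⟩ := List.append_inj' h rfl
    obtain rfl : 1 = x := by simpa using h
    rfl
  · rintro rfl
    exact ⟨u, 1, rfl, rfl⟩

theorem step_counterStack_succ {q : SimState B σ} {c : ℕ} {a : SimLetter B}
    {d : SimState B σ × _} :
    (simDPDA D n).Step a (q, counterStack (c + 1)) d ↔
      d = ((simδ D n q a 1).1, counterStack c ++ (simδ D n q a 1).2) := by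
  rw [counterStack_succ, step_append_one]

/-- A configuration from which the final state cannot be reached. -/
def IsDead (c : SimState B σ × List (Fin 2)) : Prop :=
  ∃ i u, c = (.idle i, u ++ [1])

/-- An idle state with `1` on top pushes another `1` on every letter, so it never sees the bottom
symbol again. -/
theorem IsDead.not_run {c : SimState B σ × List (Fin 2)} (hc : IsDead c) (w : List (SimLetter B))
    (v : List (Fin 2)) : ¬ (simDPDA D n).Run w c (.final, v) := by
  induction w generalizing c with
  | nil =>
    obtain ⟨i, u, rfl⟩ := hc
    simp [DPDA.Run]
  | cons a w ih =>
    obtain ⟨i, u, rfl⟩ := hc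
    rintro ⟨d, h, h'⟩
    refine ih ?_ h'
    rw [step_append_one.1 h]
    refine ⟨i, u ++ [1], ?_⟩
    cases a <;> simp [simδ]

theorem run_final (w : List (SimLetter B)) {x : Fin 2} {d : SimState B σ × List (Fin 2)} :
    (simDPDA D n).Run w (.final, [x]) d ↔ d = (.final, [x]) := by
  induction w with
  | nil => simp [DPDA.Run, eq_comm]
  | cons a w ih =>
    constructor
    · rintro ⟨_, ⟨u, y, h, rfl⟩, h'⟩
      obtain ⟨rfl, rfl⟩ : u = [] ∧ x = y := by
        simpa using List.append_inj' (s₁ := []) (t₁ := [x]) h rfl |>.imp Eq.symm id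
      exact ih.1 h'
    · rintro rfl
      exact ⟨_, ⟨[], x, rfl, rfl⟩, ih.2 rfl⟩

theorem step_start_idle {i : Fin B} {c : ℕ} {d : SimState B σ × List (Fin 2)}
    (h : (simDPDA D n).Step .start (.idle i, counterStack c) d) :
    IsDead d ∨ d = (.live i D.start, counterStack (initStore n i)) := by
  cases c with
  | zero => exact .inr (by rw [step_counterStack_zero.1 h]; simp [simδ])
  | succ c => exact .inl ⟨i, counterStack c ++ [1], by rw [step_counterStack_succ.1 h]; simp [simδ]⟩

theorem step_start_live {i : Fin B} {s : σ} {c : ℕ} {d : SimState B σ × List (Fin 2)}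
    (h : (simDPDA D n).Step .start (.live i s, counterStack c) d) :
    IsDead d ∨ d = (.live i D.start, counterStack (initStore n i)) := by
  cases c with
  | zero => exact .inr (by rw [step_counterStack_zero.1 h]; simp [simδ])
  | succ c => exact .inl ⟨i, counterStack c ++ [1], by rw [step_counterStack_succ.1 h]; simp [simδ]⟩

theorem step_finish_live {i : Fin B} {s : σ} {c : ℕ} {d : SimState B σ × List (Fin 2)}
    (h : (simDPDA D n).Step .finish (.live i s, counterStack c) d) :
    IsDead d ∨ s ∈ D.accept := by
  by_cases hs : s ∈ D.accept
  · exact .inr hs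
  · left
    cases c with
    | zero => exact ⟨i, [0], by rw [step_counterStack_zero.1 h]; simp [simδ, hs]⟩
    | succ c => exact ⟨i, counterStack c ++ [1], by
        rw [step_counterStack_succ.1 h]; simp [simδ]⟩

theorem step_act_live {i j : Fin B} {a : CounterOp} {s : σ} {c : ℕ}
    {d : SimState B σ × List (Fin 2)}
    (h : (simDPDA D n).Step (.act j a) (.live i s, counterStack c) d) :
    IsDead d ∨ ∃ m, (if i = j then a.Act c m else m = c) ∧
      d = (.live i (D.step s (j, a)), counterStack m) := by
  by_cases hij : i = j
  · subst hij
    simp only [if_true]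
    cases c with
    | zero =>
      rw [step_counterStack_zero] at h
      subst h
      cases a with
      | inc => exact .inr ⟨1, rfl, by simp [simδ, CounterOp.write, counterStack]⟩
      | dec => exact .inl ⟨i, [0], by simp [simδ, CounterOp.write]⟩
      | zero => exact .inr ⟨0, ⟨rfl, rfl⟩, by simp [simδ, CounterOp.write, counterStack]⟩
    | succ c =>
      rw [step_counterStack_succ] at h
      subst h
      cases a with
      | inc => exact .inr ⟨c + 2, rfl, by simp [simδ, CounterOp.write, counterStack_succ]⟩
      | dec => exact .inr ⟨c, rfl, by simp [simδ, CounterOp.write]⟩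
      | zero => exact .inl ⟨i, counterStack c ++ [1], by simp [simδ, CounterOp.write]⟩
  · simp only [if_neg hij]
    refine .inr ⟨c, rfl, ?_⟩
    cases c with
    | zero =>
      rw [step_counterStack_zero] at h
      subst h
      simp [simδ, hij, counterStack]
    | succ c =>
      rw [step_counterStack_succ] at h
      subst h
      simp [simδ, hij, counterStack_succ]

theorem step_act_live_of_act {i j : Fin B} {a : CounterOp} {s : σ} {c m : ℕ}
    (h : if i = j then a.Act c m else m = c) :
    (simDPDA D n).Step (.act j a) (.live i s, counterStack c)
      (.live i (D.step s (j, a)), counterStack m) := by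
  by_cases hij : i = j
  · subst hij
    rw [if_pos rfl] at h
    cases c with
    | zero =>
      rw [step_counterStack_zero]
      cases a with
      | inc => obtain rfl : m = 1 := h; simp [simδ, CounterOp.write, counterStack]
      | dec => exact absurd h (by simp [CounterOp.Act])
      | zero => obtain rfl : m = 0 := h.2; simp [simδ, CounterOp.write, counterStack]
    | succ c =>
      rw [step_counterStack_succ]
      cases a with
      | inc =>
        obtain rfl : m = c + 1 + 1 := h
        simp [simδ, CounterOp.write, counterStack_succ]
      | dec =>
        obtain rfl : c = m := by simpa [CounterOp.Act] using h
        simp [simδ, CounterOp.write]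
      | zero => exact absurd h.1 (by simp)
  · rw [if_neg hij] at h
    subst h
    cases m with
    | zero => rw [step_counterStack_zero]; simp [simδ, hij, counterStack]
    | succ c => rw [step_counterStack_succ]; simp [simδ, hij, counterStack_succ]

/-- No copy may die, so up to the first `start` or `finish` each action is legal for its counter. At
`finish` the current run is complete; a further `start` resets all copies simultaneously, which is
why the second alternative is needed. -/
theorem exists_counterRun_of_run [NeZero B] (w : List (SimLetter B)) (s : σ) (t : ℕ → ℕ)
    (h : ∀ i : Fin B, ∃ v, (simDPDA D n).Run w (.live i s, counterStack (t i)) (.final, v)) :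
    (∃ w t', D.evalFrom s w ∈ D.accept ∧ CounterRun w t t') ∨
      ∃ w t', D.evalFrom D.start w ∈ D.accept ∧ CounterRun w (initStore n) t' := by
  induction w generalizing s t with
  | nil =>
    obtain ⟨v, hv⟩ := h 0
    simp [DPDA.Run] at hv
  | cons a w ih =>
    choose v d hd hv using h
    have hnd : ∀ i, ¬ IsDead (d i) := fun i hi => hi.not_run w _ (hv i)
    cases a with
    | start =>
      refine .inr ?_
      have := ih D.start (initStore n) fun i => ⟨v i, by
        rw [← (step_start_live (hd i)).resolve_left (hnd i)]; exact hv i⟩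
      -- After the reset, both alternatives describe a run from `initStore n`.
      exact this.elim id id
    | finish =>
      exact .inl ⟨[], t, (step_finish_live (hd 0)).resolve_left (hnd 0), rfl⟩
    | act j a =>
      choose m hm hdm using fun i => (step_act_live (hd i)).resolve_left (hnd i)
      have hj := hm j
      rw [if_pos rfl] at hj
      have ht : ∀ i : Fin B, Function.update t j (m j) i = m i := by
        intro i
        by_cases hij : i = j
        · subst hij; simp
        · have := hm i
          rw [if_neg hij] at this
          rw [Function.update_of_ne (by simpa [Fin.ext_iff] using hij), this]
      refine (ih (D.step s (j, a)) (Function.update t j (m j)) fun i => ⟨v i, by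
        rw [ht, ← hdm]; exact hv i⟩).imp_left ?_
      rintro ⟨w', t', h1, h2⟩
      exact ⟨(j, a) :: w', t', h1, _, ⟨_, hj, rfl⟩, h2⟩

theorem run_of_counterRun (w : List (Fin B × CounterOp)) (s : σ) (t t' : ℕ → ℕ)
    (h : CounterRun (w.map fun p => ((p.1 : ℕ), p.2)) t t') (i : Fin B) :
    (simDPDA D n).Run (w.map fun p => .act p.1 p.2) (.live i s, counterStack (t i))
      (.live i (D.evalFrom s (w.map fun p => ((p.1 : ℕ), p.2))), counterStack (t' i)) := by
  induction w generalizing s t with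
  | nil => obtain rfl : t' = t := h; rfl
  | cons p w ih =>
    obtain ⟨j, a⟩ := p
    obtain ⟨_, ⟨m, hm, rfl⟩, h⟩ := h
    refine ⟨_, step_act_live_of_act ?_, ih _ _ h⟩
    split_ifs with hij
    · subst hij
      simpa using hm
    · exact Function.update_of_ne (by simpa [Fin.ext_iff] using hij) _ _

/-- The run from `final` forces the common state to be `final`. Following the idle states then
suffices: their first letter must be `start`, since any other letter kills them. -/
theorem exists_counterRun_of_synchronizesArb [NeZero B] {w : List (SimLetter B)}
    (h : (simDPDA D n).SynchronizesArb w) :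
    ∃ w t', D.evalFrom D.start w ∈ D.accept ∧ CounterRun w (initStore n) t' := by
  obtain ⟨p, hp⟩ := h
  obtain rfl : p = .final := by
    obtain ⟨v, hv⟩ := hp .final
    exact congrArg Prod.fst ((run_final w).1 hv)
  choose v hv using fun i => hp (.idle i)
  cases w with
  | nil => simpa [DPDA.Run] using hv 0
  | cons a w =>
    choose d hd hv using hv
    have hnd : ∀ i, ¬ IsDead (d i) := fun i hi => hi.not_run w _ (hv i)
    have hdead : ∀ l, simδ D n (.idle 0) a 0 = (.idle 0, [0, 1]) → l := fun l h =>
      absurd ⟨0, [0], by rw [step_counterStack_zero.1 (hd 0), h]; rfl⟩ (hnd 0)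
    cases a with
    | start =>
      refine (exists_counterRun_of_run w D.start (initStore n) fun i => ⟨v i, ?_⟩).elim id id
      rw [← (step_start_idle (c := 0) (hd i)).resolve_left (hnd i)]
      exact hv i
    | finish => exact hdead _ rfl
    | act j a => exact hdead _ rfl

/-- On the bottom symbol, `start` sends the idle and live states of copy `i` to the same
configuration, so one run per copy has to be followed. -/
theorem synchronizesEmpty_of_counterRun {w : List (Fin B × CounterOp)}
    (hw : D.evalFrom D.start (w.map fun p => ((p.1 : ℕ), p.2)) ∈ D.accept)
    (h : CounterRun (w.map fun p => ((p.1 : ℕ), p.2)) (initStore n) 0) :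
    (simDPDA D n).SynchronizesEmpty (.start :: w.map (fun p => .act p.1 p.2) ++ [.finish]) := by
  have hlive : ∀ i : Fin B, (simDPDA D n).Run (w.map (fun p => .act p.1 p.2) ++ [.finish])
      (.live i D.start, counterStack (initStore n i)) (.final, [0]) := fun i => by
    refine DPDA.run_append _ _ _ _ _ _ (run_of_counterRun w D.start _ _ h i)
      ⟨_, step_counterStack_zero.2 rfl, ?_⟩
    simp [simδ, hw, DPDA.Run]
  refine ⟨.final, fun q => ?_⟩
  cases q with
  | final => exact (run_final _).2 rfl
  | idle i => exact ⟨_, step_counterStack_zero.2 rfl, by simpa [simδ, simDPDA] using hlive i⟩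
  | live i s => exact ⟨_, step_counterStack_zero.2 rfl, by simpa [simδ, simDPDA] using hlive i⟩

/-- The input `n` enters the table only through the words written on `start`; this makes the table
computable in `n` although `simδ` is defined classically. -/
theorem simδ_eq (q : SimState B σ) (a : SimLetter B) (x : Fin 2) :
    (∃ c, ∀ n, simδ D n q a x = c) ∨
      ∃ r, ∃ i : ℕ, ∀ n, simδ D n q a x = (r, counterStack (initStore n i)) := by
  rcases q with _ | i | ⟨i, s⟩ <;> rcases a with _ | _ | ⟨j, a⟩
  case idle.start | live.start =>
    by_cases hx : x = 0
    · exact .inr ⟨_, i, fun n => if_pos hx⟩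
    · exact .inl ⟨_, fun n => if_neg hx⟩
  all_goals exact .inl ⟨_, fun n => rfl⟩

/-! ### Computability of the transition table -/

variable (B D n)

/-- The simulating automaton as an input of a decision problem. -/
noncomputable def simDCA [Finite σ] : DCA where
  numStates := Nat.card (SimState B σ)
  numLetters := Nat.card (SimLetter B)
  numStackSymbols := 2
  aut := (simDPDA D n).reindex (Finite.equivFin _) (Finite.equivFin _)
  isDCA := by
    have : ({0}ᶜ : Set (Fin 2)) = {1} := by
      ext x; fin_cases x <;> simp
    exact (congrArg Set.ncard this).trans (Set.ncard_singleton _)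

theorem computable_code_simDCA [Finite σ] : Computable fun n => (simDCA B D n).code := by
  have entry : ∀ (q : Fin (Nat.card (SimState B σ))) (a : Fin (Nat.card (SimLetter B)))
      (x : Fin 2), Computable fun n =>
        ((Finite.equivFin (SimState B σ) (simδ D n ((Finite.equivFin _).symm q)
          ((Finite.equivFin _).symm a) x).1 : ℕ),
        (simδ D n ((Finite.equivFin _).symm q) ((Finite.equivFin _).symm a) x).2.map Fin.val) := by
    intro q a x
    rcases simδ_eq (D := D) ((Finite.equivFin _).symm q) ((Finite.equivFin _).symm a) x with
      ⟨c, hc⟩ | ⟨r, i, h⟩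
    · simp only [hc]
      exact Computable.const _
    · simp only [h]
      refine (Computable.const _).pair ?_
      -- Only counter `0` starts with `n`: its word is the bottom symbol followed by `n` ones.
      by_cases hi : i = 0
      · have : Primrec fun n => 0 :: (List.range n).map fun _ => 1 :=
          Primrec.list_cons.comp (Primrec.const 0)
            (Primrec.list_map Primrec.list_range (Primrec₂.const 1))
        exact this.to_comp.of_eq fun n => by simp [initStore, hi, counterStack]
      · simp only [initStore, if_neg hi]
        exact Computable.const _
  have table := (Computable.const (α := ℕ) (Nat.card (SimState B σ))).pair
    ((Computable.const (Nat.card (SimLetter B))).pair ((Computable.const 2).pair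
      ((Computable.const 0).pair (Computable.list_ofFn fun q => Computable.list_ofFn fun a =>
        Computable.list_ofFn fun x => entry q a x))))
  exact table.of_eq fun n => rfl

end Simulation

/-! ### The reduction -/

theorem DCA.not_decidableProblem_of_reduction {p : ℕ → Prop} (hp : ¬ ComputablePred p)
    {M : ℕ → DCA} (hM : Computable fun n => (M n).code) {X : DCA → Prop}
    (hX : ∀ n, X (M n) ↔ p n) : ¬ DCA.DecidableProblem X := by
  rintro ⟨R, ⟨_, hR⟩, h⟩
  have h' : ComputablePred fun n => R (M n).code := ⟨fun _ => inferInstance, hR.comp hM⟩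
  exact hp (h'.of_eq fun n => (h (M n)).trans (hX n))

theorem theorem1 :
    ¬ DCA.DecidableProblem DCA.SyncEmpty ∧
    ¬ DCA.DecidableProblem DCA.SyncSame ∧
    ¬ DCA.DecidableProblem DCA.SyncArb := by
  obtain ⟨p, P, hp, h1, h2⟩ := exists_counterProg_not_computablePred
  obtain ⟨σ, _, D, hD⟩ := P.isRegular_matches'
  obtain ⟨B, hB⟩ := P.exists_bound
  have hacc : ∀ w, D.evalFrom D.start w ∈ D.accept ↔ w ∈ P.matches' := fun w => by
    rw [← hD]; rfl
  -- `B + 1` guarantees at least one copy: with none, `final` would be the only state and every word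
  -- would synchronize.
  have hempty : ∀ n, p n → (simDCA (B + 1) D n).SyncEmpty := by
    intro n hn
    obtain ⟨w, hw, hr⟩ := h2 n hn
    obtain ⟨w, rfl⟩ : w ∈ Set.range
        (List.map fun q : Fin (B + 1) × CounterOp => ((q.1 : ℕ), q.2)) := by
      rw [Set.range_list_map]
      exact fun a ha => ⟨(⟨a.1, (hB w hw a ha).trans (Nat.lt_succ_self B)⟩, a.2), rfl⟩
    exact ⟨_, DPDA.synchronizesEmpty_reindex _ _
      (synchronizesEmpty_of_counterRun ((hacc _).2 hw) hr)⟩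
  have harb : ∀ n, (simDCA (B + 1) D n).SyncArb → p n := by
    rintro n ⟨w, hw⟩
    obtain ⟨w, s', hw, hr⟩ :=
      exists_counterRun_of_synchronizesArb (DPDA.synchronizesArb_of_reindex _ _ hw)
    exact h1 n s' ⟨w, (hacc w).1 hw, hr⟩
  have hes : ∀ M : DCA, M.SyncEmpty → M.SyncSame := fun _ ⟨w, h⟩ => ⟨w, h.same⟩
  have hsa : ∀ M : DCA, M.SyncSame → M.SyncArb := fun _ ⟨w, h⟩ => ⟨w, h.arb⟩
  have hM := computable_code_simDCA (B + 1) D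
  exact ⟨DCA.not_decidableProblem_of_reduction hp hM fun n =>
      ⟨fun h => harb n (hsa _ (hes _ h)), hempty n⟩,
    DCA.not_decidableProblem_of_reduction hp hM fun n =>
      ⟨fun h => harb n (hsa _ h), fun h => hes _ (hempty n h)⟩,
    DCA.not_decidableProblem_of_reduction hp hM fun n =>
      ⟨harb n, fun h => hsa _ (hes _ (hempty n h))⟩⟩
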